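/- Let $p\in[1,\infty)$, and let $A$ be a complex Banach algebra with a unit $1$ satisfying $\|1\|\le 1$. Assume that $A$ is an $L^p$-operator algebra, that is, there exist a measure space $(\Omega,\mu)$ and an isometric (not necessarily unital) algebra homomorphism $A\to\mathcal{B}(L^p(\Omega,\mu))$, where $L^p(\Omega,\mu)$ is the complex $L^p$-space. An element $h\in A$ is called hermitian if $\|\exp(ith)\|=1$ for all $t\in\mathbb{R}$. An element $a\in A$ is called Moore-Penrose invertible if there is $b\in A$ such that $a=aba$, $b=bab$, and $ab$ and $ba$ are hermitian; such an element $b$ is unique and is denoted by $a^\dagger$. Let $A_{\mathrm{MP}}$ be the set of Moore-Penrose invertible elements of $A$. Let $(a_n)_{n\in\mathbb{N}}$ be a sequence in $A_{\mathrm{MP}}$ that converges in norm to an element $a\in A_{\mathrm{MP}}$. Then \[ a_n^\dagger\to a^\dagger \text{ in norm}\quad\Longleftrightarrow\quad \sup_{n\in\mathbb{N}}\|a_n^\dagger\|<\infty . \] -/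

import Mathlib

open MeasureTheory Filter Topology
open scoped ENNReal

universe u v

noncomputable section

section MoorePenrose

variable {A : Type*} [NormedRing A] [NormedAlgebra ℂ A]

/-- An element `a` of a unital complex Banach algebra is hermitian if `‖exp (i t a)‖ = 1` for every
real number `t`. -/
def IsHermitianElement (a : A) : Prop :=
  ∀ t : ℝ, ‖NormedSpace.exp ((Complex.I * (t : ℂ)) • a)‖ = 1

/-- `b` is a Moore-Penrose inverse of `a`: `a = aba`, `b = bab`, and `ab`, `ba` are hermitian. -/
structure IsMoorePenroseInverse (a b : A) : Prop where
  mul_mul_left : a = a * b * a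
  mul_mul_right : b = b * a * b
  hermitian_left : IsHermitianElement (a * b)
  hermitian_right : IsHermitianElement (b * a)

variable (A) in
/-- The set `A_MP` of Moore-Penrose invertible elements of `A`. -/
def moorePenroseInvertible : Set A := {a | ∃ b : A, IsMoorePenroseInverse a b}

open scoped Classical in
/-- The Moore-Penrose inverse `a†` of a Moore-Penrose invertible element `a` (and `0` for any other
element). It is well defined by `IsMoorePenroseInverse.unique` and
`IsMoorePenroseInverse.moorePenroseInverse_eq` below. -/
def moorePenroseInverse (a : A) : A :=
  if h : ∃ b : A, IsMoorePenroseInverse a b then h.choose else 0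

theorem exp_smul_of_idempotent [CompleteSpace A] {e : A} (he : e * e = e) (z : ℂ) :
    NormedSpace.exp (z • e) = 1 + (Complex.exp z - 1) • e := by
  have h1 := NormedSpace.exp_series_hasSum_exp' (𝕂 := ℂ) (z • e)
  have h2 : HasSum (fun n : ℕ => (((n.factorial : ℂ)⁻¹) • z ^ n) • e) (Complex.exp z • e) := by
    have := NormedSpace.exp_series_hasSum_exp' (𝕂 := ℂ) z
    rw [← Complex.exp_eq_exp_ℂ] at this
    exact this.smul_const e
  have h3 : HasSum (fun n : ℕ => if n = 0 then (1 - e : A) else 0) (1 - e) :=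
    hasSum_ite_eq 0 (1 - e)
  have h4 := h2.add h3
  have h5 : ∀ n : ℕ, e ^ (n + 1) = e := by
    intro n
    induction n with
    | zero => simp
    | succ k ih => rw [pow_succ, ih, he]
  have h6 : (fun n : ℕ => ((n.factorial : ℂ)⁻¹) • (z • e) ^ n) =
      fun n : ℕ => (((n.factorial : ℂ)⁻¹) • z ^ n) • e + if n = 0 then (1 - e : A) else 0 := by
    funext n
    cases n with
    | zero => simp
    | succ k => simp [smul_pow, h5, smul_smul]
  rw [h6] at h1
  rw [h1.unique h4, sub_smul, one_smul]
  abel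

theorem eq_zero_of_sq_zero_of_norm_le {n : A} (hnn : n * n = 0)
    (hle : ‖1 + (-2 : ℂ) • n‖ ≤ 1) : n = 0 := by
  have hpow : ∀ k : ℕ, (1 + (-2 : ℂ) • n) ^ (k + 1) = 1 + ((k + 1 : ℂ) * (-2)) • n := by
    intro k
    induction k with
    | zero => simp
    | succ k ih =>
      rw [pow_succ, ih]
      simp only [mul_add, add_mul, smul_mul_assoc, mul_smul_comm, hnn, one_mul, mul_one, smul_zero]
      push_cast
      module
  have hbound : ∀ k : ℕ, (k : ℝ) * ‖n‖ ≤ 1 + ‖(1 : A)‖ := by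
    intro k
    have h1 : ‖1 + ((k + 1 : ℂ) * (-2)) • n‖ ≤ 1 := by
      rw [← hpow]
      exact (norm_pow_le' _ k.succ_pos).trans (pow_le_one₀ (norm_nonneg _) hle)
    have h2 : ‖((k + 1 : ℂ) * (-2)) • n‖ ≤ 1 + ‖(1 : A)‖ := by
      have : ((k + 1 : ℂ) * (-2)) • n = (1 + ((k + 1 : ℂ) * (-2)) • n) - 1 := by abel
      rw [this]
      exact (norm_sub_le _ _).trans (by linarith)
    rw [norm_smul, norm_mul] at h2
    have h3 : ‖(k + 1 : ℂ)‖ = k + 1 := by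
      have := Complex.norm_natCast (k + 1)
      push_cast at this
      exact this
    rw [h3] at h2
    norm_num at h2
    nlinarith [norm_nonneg n, mul_nonneg (Nat.cast_nonneg (α := ℝ) k) (norm_nonneg n)]
  by_contra hne
  have hpos : 0 < ‖n‖ := norm_pos_iff.mpr hne
  obtain ⟨k, hk⟩ := exists_nat_gt ((1 + ‖(1 : A)‖) / ‖n‖)
  rw [div_lt_iff₀ hpos] at hk
  exact absurd (hbound k) (not_le.mpr hk)

theorem IsHermitianElement.norm_one_sub_two [CompleteSpace A] {g : A} (hg : g * g = g)
    (hh : IsHermitianElement g) : ‖1 + (-2 : ℂ) • g‖ = 1 := by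
  have h := hh Real.pi
  rw [exp_smul_of_idempotent hg, mul_comm, Complex.exp_pi_mul_I] at h
  norm_num at h ⊢
  exact h

/-- Hermitian idempotents with the same range or with the same kernel coincide. -/
theorem hermitian_idempotent_eq [CompleteSpace A] {e f : A} (he : e * e = e) (hf : f * f = f)
    (h : (e * f = f ∧ f * e = e) ∨ (e * f = e ∧ f * e = f)) (hhe : IsHermitianElement e)
    (hhf : IsHermitianElement f) : e = f := by
  have hle : ‖(1 + (-2 : ℂ) • e) * (1 + (-2 : ℂ) • f)‖ ≤ 1 := by
    refine (norm_mul_le _ _).trans ?_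
    rw [hhe.norm_one_sub_two he, hhf.norm_one_sub_two hf, one_mul]
  rcases h with ⟨hef, hfe⟩ | ⟨hef, hfe⟩
  · refine sub_eq_zero.mp (eq_zero_of_sq_zero_of_norm_le ?_ ?_)
    · simp only [sub_mul, mul_sub, he, hf, hef, hfe]; abel
    · convert hle using 2
      simp only [mul_add, add_mul, smul_mul_assoc, mul_smul_comm, hef, one_mul, mul_one]
      module
  · refine (sub_eq_zero.mp (eq_zero_of_sq_zero_of_norm_le ?_ ?_)).symm
    · simp only [sub_mul, mul_sub, he, hf, hef, hfe]; abel
    · convert hle using 2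
      simp only [mul_add, add_mul, smul_mul_assoc, mul_smul_comm, hef, one_mul, mul_one]
      module

/-- Moore-Penrose inverses are unique. -/
theorem IsMoorePenroseInverse.unique [CompleteSpace A] {a b c : A}
    (hb : IsMoorePenroseInverse a b) (hc : IsMoorePenroseInverse a c) : b = c := by
  have b1 : a * b * a = a := hb.mul_mul_left.symm
  have b2 : b * a * b = b := hb.mul_mul_right.symm
  have c1 : a * c * a = a := hc.mul_mul_left.symm
  have c2 : c * a * c = c := hc.mul_mul_right.symm
  have hl : a * b = a * c :=
    hermitian_idempotent_eq (by rw [← mul_assoc, b1]) (by rw [← mul_assoc, c1])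
      (Or.inl ⟨by rw [← mul_assoc, b1], by rw [← mul_assoc, c1]⟩)
      hb.hermitian_left hc.hermitian_left
  have hr : b * a = c * a :=
    hermitian_idempotent_eq (by rw [← mul_assoc, b2]) (by rw [← mul_assoc, c2])
      (Or.inr ⟨by rw [mul_assoc, ← mul_assoc a, c1], by rw [mul_assoc, ← mul_assoc a, b1]⟩)
      hb.hermitian_right hc.hermitian_right
  rw [← b2, hr, mul_assoc, hl, ← mul_assoc, c2]

theorem IsMoorePenroseInverse.moorePenroseInverse_eq [CompleteSpace A] {a b : A}
    (h : IsMoorePenroseInverse a b) : moorePenroseInverse a = b := by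
  have hex : ∃ b : A, IsMoorePenroseInverse a b := ⟨b, h⟩
  rw [moorePenroseInverse, dif_pos hex]
  exact hex.choose_spec.unique h

end MoorePenrose

/-- `A` is an `L^p`-operator algebra: it admits an isometric (not necessarily unital)
representation by bounded operators on the complex space `L^p(Ω, μ)` of some measure space
`(Ω, μ)`. -/
def IsLpOperatorAlgebra (p : ℝ≥0∞) [Fact (1 ≤ p)] (A : Type u) [NormedRing A]
    [NormedAlgebra ℂ A] : Prop :=
  ∃ (Ω : Type v) (_ : MeasurableSpace Ω) (μ : Measure Ω)
    (φ : A →ₙₐ[ℂ] (Lp ℂ p μ →L[ℂ] Lp ℂ p μ)), Isometry φ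

end

section MoorePenroseContinuity

variable {A : Type*} [NormedRing A] [NormedAlgebra ℂ A]

/-! Convergent sequences are bounded; the converse makes the uniqueness proof for Moore-Penrose
inverses quantitative. A hermitian idempotent `g` gives the norm-one element `1 - 2g = exp(iπg)`. If
idempotents `e`, `f` almost share a range or a kernel, then `x = ±(e - f)` is almost square-zero and
`(1 - 2e)(1 - 2f)` is almost `1 - 2x`. Its powers are contractions close to `1 - 2kx`, which forces
`x` to be small. Boundedness of `b n` makes `a n * b n` almost share its range with `a₀ * b₀`, and
`b n * a n` its kernel with `b₀ * a₀`. -/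

/-- Approximate version of `eq_zero_of_sq_zero_of_norm_le`: if `x n` is asymptotically square-zero
and `1 - 2 x n` is asymptotic to a sequence of contractions, then `x n` tends to zero. -/
theorem tendsto_zero_of_sq_tendsto_zero_of_norm_le {x w : ℕ → A} (hw : ∀ n, ‖w n‖ ≤ 1)
    (hsq : Tendsto (fun n => x n * x n) atTop (𝓝 0))
    (hwx : Tendsto (fun n => w n - (1 + (-2 : ℂ) • x n)) atTop (𝓝 0)) :
    Tendsto x atTop (𝓝 0) := by
  have hwb : IsBoundedUnder (· ≤ ·) atTop (fun n => ‖w n‖) := isBoundedUnder_of ⟨1, hw⟩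
  have hxb : IsBoundedUnder (· ≤ ·) atTop (fun n => ‖1 + (-2 : ℂ) • x n‖) := by
    obtain ⟨C, hC⟩ := hwx.norm.isBoundedUnder_le
    refine ⟨1 + C, ?_⟩
    rw [eventually_map] at hC ⊢
    filter_upwards [hC] with n hn
    calc ‖1 + (-2 : ℂ) • x n‖ = ‖w n - (w n - (1 + (-2 : ℂ) • x n))‖ := by rw [sub_sub_cancel]
      _ ≤ ‖w n‖ + ‖w n - (1 + (-2 : ℂ) • x n)‖ := norm_sub_le _ _
      _ ≤ 1 + C := add_le_add (hw n) hn
  have hpow : ∀ k : ℕ,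
      Tendsto (fun n => w n ^ (k + 1) - (1 + ((k + 1 : ℂ) * (-2)) • x n)) atTop (𝓝 0) := by
    intro k
    induction k with
    | zero => simpa using hwx
    | succ k ih =>
      have hb : IsBoundedUnder (· ≤ ·) atTop (norm ∘ fun n => w n ^ (k + 1)) :=
        isBoundedUnder_of ⟨1, fun n =>
          (norm_pow_le' _ k.succ_pos).trans (pow_le_one₀ (norm_nonneg _) (hw n))⟩
      -- With `v = 1 - 2x`, the next error is `w^(k+1) (w - v) + (w^(k+1) - (1 - 2(k+1)x)) v +
      -- 4(k+1) x²`.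
      have h := ((isBoundedUnder_le_mul_tendsto_zero hb hwx).add
        (ih.zero_mul_isBoundedUnder_le hxb)).add (hsq.const_smul (4 * (k + 1 : ℂ)))
      simp only [smul_zero, add_zero] at h
      refine h.congr fun n => ?_
      rw [pow_succ (w n) (k + 1)]
      simp only [mul_add, add_mul, mul_sub, sub_mul, smul_mul_assoc, mul_smul_comm, one_mul,
        mul_one]
      push_cast
      module
  rw [Metric.tendsto_atTop]
  intro ε hε
  -- The power is fixed before `n`, so no uniformity in `k` is needed; an error below `1` gives
  -- `2(k+1)‖x n‖ ≤ 2 + ‖1‖`.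
  obtain ⟨k, hk⟩ := exists_nat_gt ((2 + ‖(1 : A)‖) / ε)
  rw [div_lt_iff₀ hε] at hk
  obtain ⟨N, hN⟩ := Metric.tendsto_atTop.mp (hpow k) 1 one_pos
  refine ⟨N, fun n hn => ?_⟩
  have h1 := hN n hn
  rw [dist_zero_right] at h1 ⊢
  have h2 : ‖((k + 1 : ℂ) * (-2)) • x n‖ ≤ 1 + ‖(1 : A)‖ + 1 := by
    have : ((k + 1 : ℂ) * (-2)) • x n =
        w n ^ (k + 1) - 1 - (w n ^ (k + 1) - (1 + ((k + 1 : ℂ) * (-2)) • x n)) := by abel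
    rw [this]
    have h3 : ‖w n ^ (k + 1)‖ ≤ 1 :=
      (norm_pow_le' _ k.succ_pos).trans (pow_le_one₀ (norm_nonneg _) (hw n))
    linarith [norm_sub_le (w n ^ (k + 1) - 1)
      (w n ^ (k + 1) - (1 + ((k + 1 : ℂ) * (-2)) • x n)), norm_sub_le (w n ^ (k + 1)) 1]
  rw [norm_smul, norm_mul] at h2
  have h3 : ‖(k + 1 : ℂ)‖ = k + 1 := by
    have := Complex.norm_natCast (k + 1)
    push_cast at this
    exact this
  rw [h3] at h2
  norm_num at h2
  by_contra! hge
  nlinarith [norm_nonneg (x n), mul_le_mul_of_nonneg_left hge (Nat.cast_nonneg (α := ℝ) k),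
    mul_nonneg (Nat.cast_nonneg (α := ℝ) k) (norm_nonneg (x n))]

/-- Hermitian idempotents whose ranges, or whose kernels, asymptotically agree with those of a
hermitian idempotent `e` converge to `e`. -/
theorem tendsto_of_hermitian_idempotent [CompleteSpace A] {e : A} {f : ℕ → A} (he : e * e = e)
    (hf : ∀ n, f n * f n = f n) (hhe : IsHermitianElement e) (hhf : ∀ n, IsHermitianElement (f n))
    (h : (Tendsto (fun n => e * f n - f n) atTop (𝓝 0) ∧
        Tendsto (fun n => f n * e - e) atTop (𝓝 0)) ∨
      (Tendsto (fun n => e * f n - e) atTop (𝓝 0) ∧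
        Tendsto (fun n => f n * e - f n) atTop (𝓝 0))) :
    Tendsto f atTop (𝓝 e) := by
  have hle : ∀ n, ‖(1 + (-2 : ℂ) • e) * (1 + (-2 : ℂ) • f n)‖ ≤ 1 := by
    intro n
    refine (norm_mul_le _ _).trans ?_
    rw [hhe.norm_one_sub_two he, (hhf n).norm_one_sub_two (hf n), one_mul]
  rw [← tendsto_sub_nhds_zero_iff]
  rcases h with ⟨h1, h2⟩ | ⟨h1, h2⟩
  -- Here `x² = -(ef - f) - (fe - e)` and `(1 - 2e)(1 - 2f) - (1 - 2x) = 4(ef - f)`.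
  · have hx : Tendsto (fun n => e - f n) atTop (𝓝 0) := by
      refine tendsto_zero_of_sq_tendsto_zero_of_norm_le hle ?_ ?_
      · have h3 := (h1.add h2).neg
        simp only [add_zero, neg_zero] at h3
        refine h3.congr fun n => ?_
        simp only [sub_mul, mul_sub, he, hf]
        abel
      · have h3 := h1.const_smul (4 : ℂ)
        rw [smul_zero] at h3
        refine h3.congr fun n => ?_
        simp only [mul_add, add_mul, smul_mul_assoc, mul_smul_comm, one_mul, mul_one]
        module
    simpa using hx.neg
  -- For kernels the sign flips: `x = f - e`, with error `4(ef - e)`.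
  · refine tendsto_zero_of_sq_tendsto_zero_of_norm_le hle ?_ ?_
    · have h3 := (h1.add h2).neg
      simp only [add_zero, neg_zero] at h3
      refine h3.congr fun n => ?_
      simp only [sub_mul, mul_sub, he, hf]
      abel
    · have h3 := h1.const_smul (4 : ℂ)
      rw [smul_zero] at h3
      refine h3.congr fun n => ?_
      simp only [mul_add, add_mul, smul_mul_assoc, mul_smul_comm, one_mul, mul_one]
      module

/-- In a unital Banach algebra, bounded Moore-Penrose inverses of a convergent sequence converge
to the Moore-Penrose inverse of the limit. -/
theorem IsMoorePenroseInverse.tendsto_of_isBoundedUnder [CompleteSpace A] {a b : ℕ → A} {a₀ b₀ : A}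
    (h : ∀ n, IsMoorePenroseInverse (a n) (b n)) (h₀ : IsMoorePenroseInverse a₀ b₀)
    (hlim : Tendsto a atTop (𝓝 a₀)) (hb : IsBoundedUnder (· ≤ ·) atTop (norm ∘ b)) :
    Tendsto b atTop (𝓝 b₀) := by
  have l : ∀ n, a n * b n * a n = a n := fun n => (h n).mul_mul_left.symm
  have r : ∀ n, b n * a n * b n = b n := fun n => (h n).mul_mul_right.symm
  have l₀ : a₀ * b₀ * a₀ = a₀ := h₀.mul_mul_left.symm
  have r₀ : b₀ * a₀ * b₀ = b₀ := h₀.mul_mul_right.symm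
  have hd : Tendsto (fun n => a n - a₀) atTop (𝓝 0) := tendsto_sub_nhds_zero_iff.mpr hlim
  have hdb : Tendsto (fun n => (a n - a₀) * b n) atTop (𝓝 0) := hd.zero_mul_isBoundedUnder_le hb
  have hbd : Tendsto (fun n => b n * (a n - a₀)) atTop (𝓝 0) :=
    isBoundedUnder_le_mul_tendsto_zero hb hd
  have hdb₀ : Tendsto (fun n => (a n - a₀) * b₀) atTop (𝓝 0) := by
    simpa using hd.mul_const b₀
  have hbd₀ : Tendsto (fun n => b₀ * (a n - a₀)) atTop (𝓝 0) := by
    simpa using hd.const_mul b₀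
  -- `‖1 - 2g‖ = 1` bounds hermitian idempotents uniformly.
  have hbound : ∀ {g : ℕ → A}, (∀ n, g n * g n = g n) → (∀ n, IsHermitianElement (g n)) →
      IsBoundedUnder (· ≤ ·) atTop (norm ∘ fun n => (1 : A) - g n) := by
    intro g hg hhg
    refine isBoundedUnder_of ⟨‖(1 : A)‖ + (1 + ‖(1 : A)‖), fun n => ?_⟩
    have h1 := (hhg n).norm_one_sub_two (hg n)
    have h2 : ‖(-2 : ℂ) • g n‖ ≤ 1 + ‖(1 : A)‖ := by
      have : (-2 : ℂ) • g n = (1 + (-2 : ℂ) • g n) - 1 := by abel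
      rw [this]
      exact (norm_sub_le _ _).trans_eq (by rw [h1])
    rw [norm_smul] at h2
    norm_num at h2
    have h3 := norm_sub_le (1 : A) (g n)
    simp only [Function.comp]
    linarith [norm_nonneg (g n)]
  have le : ∀ n, (a n * b n) * (a n * b n) = a n * b n := fun n => by rw [← mul_assoc, l]
  have re : ∀ n, (b n * a n) * (b n * a n) = b n * a n := fun n => by rw [← mul_assoc, r]
  have le₀ : (a₀ * b₀) * (a₀ * b₀) = a₀ * b₀ := by rw [← mul_assoc, l₀]
  have re₀ : (b₀ * a₀) * (b₀ * a₀) = b₀ * a₀ := by rw [← mul_assoc, r₀]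
  have hleft : Tendsto (fun n => a n * b n) atTop (𝓝 (a₀ * b₀)) := by
    refine tendsto_of_hermitian_idempotent le₀ le h₀.hermitian_left
      (fun n => (h n).hermitian_left) (Or.inl ⟨?_, ?_⟩)
    -- Since `a₀ * b₀ - 1` kills `a₀` from the left, `a n` may be replaced by `a n - a₀`; the other
    -- three limits use the same trick.
    · have h1 := hdb.const_mul (a₀ * b₀ - 1)
      rw [mul_zero] at h1
      refine h1.congr fun n => ?_
      simp only [sub_mul, mul_sub, one_mul, ← mul_assoc, l₀]
      abel
    · have h1 := isBoundedUnder_le_mul_tendsto_zero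
        (hbound le fun n => (h n).hermitian_left) hdb₀
      refine h1.congr fun n => ?_
      simp only [sub_mul, mul_sub, one_mul, ← mul_assoc, l]
      abel
  have hright : Tendsto (fun n => b n * a n) atTop (𝓝 (b₀ * a₀)) := by
    refine tendsto_of_hermitian_idempotent re₀ re h₀.hermitian_right
      (fun n => (h n).hermitian_right) (Or.inr ⟨?_, ?_⟩)
    · have h1 := hbd₀.zero_mul_isBoundedUnder_le
        (hbound re fun n => (h n).hermitian_right)
      refine h1.congr fun n => ?_
      have l' : b₀ * a n * b n * a n = b₀ * a n := by
        rw [mul_assoc, mul_assoc, ← mul_assoc (a n), l]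
      simp only [sub_mul, mul_sub, mul_one, ← mul_assoc, l']
      abel
    · have h1 := hbd.mul_const (b₀ * a₀ - 1)
      rw [zero_mul] at h1
      refine h1.congr fun n => ?_
      have l' : b n * a₀ * b₀ * a₀ = b n * a₀ := by
        rw [mul_assoc, mul_assoc, ← mul_assoc a₀, l₀]
      simp only [sub_mul, mul_sub, mul_one, ← mul_assoc, l']
      abel
  rw [← tendsto_sub_nhds_zero_iff] at hleft hright ⊢
  -- With `b = b n`, `a = a n`: `b - b₀ = b(ab - a₀b₀) + (ba - b₀a₀)b₀ - b(a - a₀)b₀`.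
  have h1 := ((isBoundedUnder_le_mul_tendsto_zero hb hleft).add (hright.mul_const b₀)).sub
    (hbd.mul_const b₀)
  simp only [zero_mul, add_zero, sub_zero] at h1
  refine h1.congr fun n => ?_
  simp only [sub_mul, mul_sub, ← mul_assoc, r, r₀]
  abel

theorem isMoorePenroseInverse_moorePenroseInverse [CompleteSpace A] {a : A}
    (ha : a ∈ moorePenroseInvertible A) : IsMoorePenroseInverse a (moorePenroseInverse a) := by
  obtain ⟨b, hb⟩ := ha
  rwa [hb.moorePenroseInverse_eq]

end MoorePenroseContinuity

theorem mainTheorem9 (p : ℝ≥0∞) [Fact (1 ≤ p)] (hp : p ≠ ∞)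
    (A : Type u) [NormedRing A] [NormedAlgebra ℂ A] [CompleteSpace A]
    (hone : ‖(1 : A)‖ ≤ 1) (hA : IsLpOperatorAlgebra.{u, v} p A)
    (a : ℕ → A) (a₀ : A)
    (ha : ∀ n, a n ∈ moorePenroseInvertible A) (ha₀ : a₀ ∈ moorePenroseInvertible A)
    (hlim : Tendsto a atTop (𝓝 a₀)) :
    Tendsto (fun n => moorePenroseInverse (a n)) atTop (𝓝 (moorePenroseInverse a₀)) ↔
      BddAbove (Set.range fun n => ‖moorePenroseInverse (a n)‖) := by
  refine ⟨fun h => h.norm.bddAbove_range, fun h => ?_⟩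
  exact IsMoorePenroseInverse.tendsto_of_isBoundedUnder
    (fun n => isMoorePenroseInverse_moorePenroseInverse (ha n))
    (isMoorePenroseInverse_moorePenroseInverse ha₀) hlim h.isBoundedUnder_of_range
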